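/- Let $1<p<\infty$ and let $\ell_p$ be the real sequence space with its norm $\|\cdot\|_p$. Put $$\Delta_p=\Bigl\{x\in \ell_p \;:\; x^i\ge 0 \text{ for all } i,\ \sum_{i=1}^{\infty}x^i\le 1\Bigr\},$$ a closed bounded separable convex subset of $\ell_p$. For a set $B\subseteq \ell_p$ let $M(B)$ be the set of Borel probability measures on $B$ with the topology of weak convergence. For $\mu\in M(B)$, $B\subseteq\Delta_p$, let $\mathbf b(\mu)=\int_B y\,\mu(dy)\in\Delta_p$ (Pettis integral) be its barycenter. For a bounded function $f:\Delta_p\to\mathbb R$ let $\mathrm{co}f$ be its convex hull, that is, the maximal convex function on $\Delta_p$ not exceeding $f$. Then: 1. $\Delta_p$ is pointwise $\mu$-compact: for every $x\in\overline{\mathrm{co}}\,\Delta_p=\Delta_p$, the set $\{\mu\in M(\Delta_p) : \mathbf b(\mu)=x\}$ is a compact subset of $M(\Delta_p)$. 2. (i) holds: the map $\Delta_p\times\Delta_p\to\Delta_p$, $(x,y)\mapsto\frac{x+y}{2}$, is open (that is, $\Delta_p$ is stable). 3. (ii) holds: the map $M(\Delta_p)\to\Delta_p$, $\mu\mapsto\mathbf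 b(\mu)$, is open. 4. (iii) fails: the map $M(\overline{\mathrm{extr}\,\Delta_p})\to\Delta_p$, $\mu\mapsto\mathbf b(\mu)$, is not open, where $\mathrm{extr}\,\Delta_p$ is the set of extreme points of $\Delta_p$. 5. (iv) fails: it is not true that $\mathrm{co}f$ is continuous on $\Delta_p$ for every continuous bounded function $f$ on $\Delta_p$. 6. (v) fails: it is not true that $\mathrm{co}f$ is continuous on $\Delta_p$ for every concave continuous bounded function $f$ on $\Delta_p$. In particular, the properties (i)–(v) are not equivalent for the pointwise $\mu$-compact convex set $\Delta_p$. -/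

import Mathlib

open MeasureTheory Set TopologicalSpace
open scoped ENNReal

section General

variable {E : Type*} [NormedAddCommGroup E] [NormedSpace ℝ E]

/-- The midpoint map `A × A → A`, `(x, y) ↦ (x + y) / 2`, of a convex set `A`. -/
noncomputable def midpointMap {A : Set E} (hA : Convex ℝ A) (z : A × A) : A :=
  ⟨(1 / 2 : ℝ) • ((z.1 : E) + (z.2 : E)), by
    rw [smul_add]
    exact hA z.1.2 z.2.2 (by norm_num) (by norm_num) (by norm_num)⟩

/-- The set of convex functions on `A` that do not exceed `f` on `A`
(only the values on `A` matter). -/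
def convexMinorants (A : Set E) (f : E → ℝ) : Set (E → ℝ) :=
  {g | ConvexOn ℝ A g ∧ ∀ x ∈ A, g x ≤ f x}

/-- The convex hull `co f` of a function `f` on the convex set `A`: the maximal convex function
on `A` not exceeding `f` (see `convexHullFun_mem` and `le_convexHullFun`). -/
noncomputable def convexHullFun (A : Set E) (f : E → ℝ) (x : E) : ℝ :=
  sSup ((fun g : E → ℝ => g x) '' convexMinorants A f)

/-- `f` is a continuous bounded function on `A`. -/
def IsBoundedContinuousOn (A : Set E) (f : E → ℝ) : Prop :=
  ContinuousOn f A ∧ ∃ C : ℝ, ∀ x ∈ A, |f x| ≤ C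

/-- The strong CE-property: the convex hull of every continuous bounded function on `A` is
continuous on `A`. -/
def StrongCEProperty (A : Set E) : Prop :=
  ∀ f : E → ℝ, IsBoundedContinuousOn A f → ContinuousOn (convexHullFun A f) A

/-- The CE-property: the convex hull of every concave continuous bounded function on `A` is
continuous on `A`. -/
def CEProperty (A : Set E) : Prop :=
  ∀ f : E → ℝ, ConcaveOn ℝ A f → IsBoundedContinuousOn A f →
    ContinuousOn (convexHullFun A f) A

theorem le_convexHullFun {A : Set E} {f g : E → ℝ} (hg : g ∈ convexMinorants A f)
    {x : E} (hx : x ∈ A) : g x ≤ convexHullFun A f x := by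
  refine le_csSup ⟨f x, ?_⟩ ⟨g, hg, rfl⟩
  rintro _ ⟨k, hk, rfl⟩
  exact hk.2 x hx

theorem convexHullFun_mem {A : Set E} {f : E → ℝ} (hA : Convex ℝ A) {C : ℝ}
    (hC : ∀ x ∈ A, C ≤ f x) : convexHullFun A f ∈ convexMinorants A f := by
  have hne : ∀ x : E, ((fun g : E → ℝ => g x) '' convexMinorants A f).Nonempty := fun x =>
    ⟨C, fun _ => C, ⟨convexOn_const C hA, hC⟩, rfl⟩
  refine ⟨⟨hA, fun x hx y hy a b ha hb hab => ?_⟩, fun x hx => ?_⟩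
  · refine csSup_le (hne _) ?_
    rintro _ ⟨g, hg, rfl⟩
    refine (hg.1.2 hx hy ha hb hab).trans ?_
    exact add_le_add (mul_le_mul_of_nonneg_left (le_convexHullFun hg hx) ha)
      (mul_le_mul_of_nonneg_left (le_convexHullFun hg hy) hb)
  · refine csSup_le (hne x) ?_
    rintro _ ⟨g, hg, rfl⟩
    exact hg.2 x hx

variable [MeasurableSpace E]

/-- `x` is the barycenter `∫ y μ(dy)` (Pettis integral) of the probability measure `μ` on `B`. -/
def IsBarycenter {B : Set E} (μ : ProbabilityMeasure B) (x : E) : Prop :=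
  ∀ φ : E →L[ℝ] ℝ, Integrable (fun y : B => φ y) (μ : Measure B) ∧
    ∫ y : B, φ y ∂(μ : Measure B) = φ x

/-- The set of Borel probability measures on `A` with barycenter `x`. -/
def measuresWithBarycenter (A : Set E) (x : E) : Set (ProbabilityMeasure A) :=
  {μ | IsBarycenter μ x}

/-- `A` is pointwise `μ`-compact: for every `x` in the closed convex hull of `A`, the set of Borel
probability measures on `A` with barycenter `x` is compact in the topology of weak convergence. -/
def PointwiseMuCompact [BorelSpace E] (A : Set E) : Prop :=
  ∀ x ∈ closure (convexHull ℝ A), IsCompact (measuresWithBarycenter A x)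

theorem IsBarycenter.unique {B : Set E} {μ : ProbabilityMeasure B} {x y : E}
    (hx : IsBarycenter μ x) (hy : IsBarycenter μ y) : x = y := by
  refine (SeparatingDual.eq_iff_forall_dual_eq (R := ℝ)).2 fun φ => ?_
  rw [← (hx φ).2, ← (hy φ).2]

/-- Every probability measure on a subset of a closed bounded separable convex set has a barycenter
in this set. -/
theorem exists_isBarycenter [BorelSpace E] [CompleteSpace E] {A B : Set E} (hconv : Convex ℝ A)
    (hcl : IsClosed A) (hbd : Bornology.IsBounded A) (hsep : IsSeparable A) (hBA : B ⊆ A)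
    (μ : ProbabilityMeasure B) : ∃ x ∈ A, IsBarycenter μ x := by
  obtain ⟨C, hC⟩ := hbd.exists_norm_le
  have hsm : StronglyMeasurable (fun y : B => (y : E)) := by
    refine stronglyMeasurable_iff_measurable_separable.2 ⟨measurable_subtype_coe, ?_⟩
    rw [Subtype.range_coe]
    exact hsep.mono hBA
  have hint : Integrable (fun y : B => (y : E)) (μ : Measure B) :=
    Integrable.of_bound hsm.aestronglyMeasurable C
      (Filter.Eventually.of_forall fun y => hC _ (hBA y.2))
  refine ⟨∫ y : B, (y : E) ∂(μ : Measure B), ?_, fun φ => ⟨φ.integrable_comp hint, ?_⟩⟩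
  · exact hconv.integral_mem hcl (Filter.Eventually.of_forall fun y => hBA y.2) hint
  · exact φ.integral_comp_comm hint

/-- The barycenter map from the Borel probability measures on `B` to `A`, where every probability
measure on `B` has its (unique) barycenter in `A`. -/
noncomputable def barycenterMap (B A : Set E)
    (h : ∀ μ : ProbabilityMeasure B, ∃ x ∈ A, IsBarycenter μ x) (μ : ProbabilityMeasure B) : A :=
  ⟨(h μ).choose, (h μ).choose_spec.1⟩

theorem isBarycenter_barycenterMap {B A : Set E}
    (h : ∀ μ : ProbabilityMeasure B, ∃ x ∈ A, IsBarycenter μ x) (μ : ProbabilityMeasure B) :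
    IsBarycenter μ (barycenterMap B A h μ : E) :=
  (h μ).choose_spec.2

end General

section Simplex

/-- The set `Δ_p` of nonnegative sequences in the real sequence space `ℓ_p` whose coordinates have
a convergent sum that is at most one. -/
def lpSimplex (p : ℝ≥0∞) : Set (lp (fun _ : ℕ => ℝ) p) :=
  {x | (∀ i, 0 ≤ x i) ∧ Summable (fun i => x i) ∧ ∑' i, x i ≤ 1}

theorem mem_lpSimplex_iff {p : ℝ≥0∞} {x : lp (fun _ : ℕ => ℝ) p} :
    x ∈ lpSimplex p ↔ (∀ i, 0 ≤ x i) ∧ ∀ s : Finset ℕ, ∑ i ∈ s, x i ≤ 1 := by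
  constructor
  · rintro ⟨h0, hs, h1⟩
    exact ⟨h0, fun s => (hs.sum_le_tsum s fun i _ => h0 i).trans h1⟩
  · rintro ⟨h0, h1⟩
    have hs : Summable (fun i => x i) := summable_of_sum_le h0 h1
    exact ⟨h0, hs, hs.tsum_le_of_sum_le h1⟩

theorem convex_lpSimplex (p : ℝ≥0∞) : Convex ℝ (lpSimplex p) := by
  rintro x ⟨hx0, hxs, hx1⟩ y ⟨hy0, hys, hy1⟩ a b ha hb hab
  refine ⟨fun i => ?_, (hxs.mul_left a).add (hys.mul_left b), ?_⟩
  · exact add_nonneg (mul_nonneg ha (hx0 i)) (mul_nonneg hb (hy0 i))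
  · have h : ∑' i, (a • x + b • y : lp (fun _ : ℕ => ℝ) p) i
        = a * ∑' i, x i + b * ∑' i, y i := by
      rw [← tsum_mul_left, ← tsum_mul_left, ← (hxs.mul_left a).tsum_add (hys.mul_left b)]
      rfl
    rw [h]
    nlinarith

variable (p : ℝ≥0∞) [Fact (1 ≤ p)]

theorem isClosed_lpSimplex : IsClosed (lpSimplex p) := by
  have hc : ∀ i, Continuous fun x : lp (fun _ : ℕ => ℝ) p => x i := fun i =>
    (continuous_apply i).comp (lp.uniformContinuous_coe (p := p)).continuous
  have : lpSimplex p = (⋂ i, {x | 0 ≤ x i}) ∩ ⋂ s : Finset ℕ, {x | ∑ i ∈ s, x i ≤ 1} := by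
    ext x
    simp [mem_lpSimplex_iff]
  rw [this]
  exact (isClosed_iInter fun i => isClosed_le continuous_const (hc i)).inter
    (isClosed_iInter fun s => isClosed_le (continuous_finsetSum s fun i _ => hc i)
      continuous_const)

theorem isBounded_lpSimplex (hp : p ≠ ∞) : Bornology.IsBounded (lpSimplex p) := by
  have hp1 : 1 ≤ p := Fact.out
  have hp1r : 1 ≤ p.toReal := by
    simpa using ENNReal.toReal_mono hp hp1
  refine isBounded_iff_forall_norm_le.2 ⟨1, fun x hx => ?_⟩
  rw [mem_lpSimplex_iff] at hx
  refine lp.norm_le_of_forall_sum_le (by linarith) zero_le_one fun s => ?_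
  rw [Real.one_rpow]
  refine (Finset.sum_le_sum fun i _ => ?_).trans (hx.2 s)
  have h0 := hx.1 i
  have h1 : x i ≤ 1 := by simpa using hx.2 {i}
  rw [Real.norm_of_nonneg h0]
  simpa using Real.rpow_le_rpow_of_exponent_ge' h0 h1 zero_le_one hp1r

theorem isSeparable_lpSimplex (hp : p ≠ ∞) : IsSeparable (lpSimplex p) := by
  have h : IsSeparable (closure (Submodule.span ℝ
      (range fun i : ℕ => lp.single (E := fun _ : ℕ => ℝ) p i (1 : ℝ)) :
        Set (lp (fun _ : ℕ => ℝ) p))) :=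
    (countable_range _).isSeparable.span.closure
  refine h.mono fun x _ => ?_
  refine mem_closure_of_tendsto (lp.hasSum_single hp x) (Filter.Eventually.of_forall fun s => ?_)
  refine Submodule.sum_mem _ fun i _ => ?_
  have : lp.single (E := fun _ : ℕ => ℝ) p i (x i) = x i • lp.single p i (1 : ℝ) := by
    rw [← lp.single_smul, smul_eq_mul, mul_one]
  rw [this]
  exact Submodule.smul_mem _ _ (Submodule.subset_span ⟨i, rfl⟩)

variable [MeasurableSpace (lp (fun _ : ℕ => ℝ) p)] [BorelSpace (lp (fun _ : ℕ => ℝ) p)]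

theorem exists_isBarycenter_lpSimplex (hp : p ≠ ∞) (μ : ProbabilityMeasure (lpSimplex p)) :
    ∃ x ∈ lpSimplex p, IsBarycenter μ x :=
  exists_isBarycenter (convex_lpSimplex p) (isClosed_lpSimplex p) (isBounded_lpSimplex p hp)
    (isSeparable_lpSimplex p hp) Subset.rfl μ

theorem exists_isBarycenter_closure_extremePoints (hp : p ≠ ∞)
    (μ : ProbabilityMeasure (closure (extremePoints ℝ (lpSimplex p)))) :
    ∃ x ∈ lpSimplex p, IsBarycenter μ x :=
  exists_isBarycenter (convex_lpSimplex p) (isClosed_lpSimplex p) (isBounded_lpSimplex p hp)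
    (isSeparable_lpSimplex p hp)
    (closure_minimal extremePoints_subset (isClosed_lpSimplex p)) μ

end Simplex

/-! The simplex behaves well in its interior geometry and badly at the origin, because for `1 < p`
the `ℓ_p` norm does not see mass spread thinly over many coordinates.

Openness of the midpoint and barycenter maps rests on `exists_sequences_sum_eq`: if the average of
finitely many points is moved to a new point `z` of the simplex, the points can be moved along with
it, coordinate by coordinate, with error at most that of the average. The midpoint map is the case
of two equal weights. For general measures, `exists_simpleFunc_map_mem_nhds` first reduces to
finitely many atoms without changing the barycenter.

Pointwise compactness is Prokhorov's theorem: the barycenter fixes the expected coordinate sum of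
every tail, and uniformly small tail sums force total boundedness in `ℓ_p`.

The negative results share one sequence. The averages of the first `n + 1` unit vectors tend to `0`,
yet keep total mass one. Measures on the closed extreme boundary with these barycenters must live on
vectors of norm at least one, far from the Dirac measure at `0`. Likewise the convex hull of `-‖x‖`
is at most `-1` at these averages but nonnegative at `0`. -/

/-! ### Moving a convex combination of subprobability sequences. -/

section Sequences

/-- A convex combination `∑ w j • x j` of nonnegative sequences of mass at most one can be moved to
any other such sequence `z` while moving the sequences `x j` by a comparable amount. -/
theorem exists_sequences_sum_eq {ι : Type*} (s : Finset ι) {w : ι → ℝ} (hw : ∀ j ∈ s, 0 ≤ w j)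
    (hw1 : ∑ j ∈ s, w j = 1) {x : ι → ℕ → ℝ} (hx0 : ∀ j i, 0 ≤ x j i)
    (hxs : ∀ j, Summable (x j)) (hx1 : ∀ j, ∑' i, x j i ≤ 1) {z : ℕ → ℝ} (hz0 : ∀ i, 0 ≤ z i)
    (hzs : Summable z) (hz1 : ∑' i, z i ≤ 1) :
    ∃ y : ι → ℕ → ℝ, (∀ j i, 0 ≤ y j i) ∧ (∀ j, Summable (y j)) ∧ (∀ j, ∑' i, y j i ≤ 1) ∧
      (∀ i, ∑ j ∈ s, w j * y j i = z i) ∧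
      ∀ j ∈ s, ∀ i, w j * |y j i - x j i| ≤ |z i - ∑ k ∈ s, w k * x k i| := by
  set m : ℕ → ℝ := fun i => ∑ k ∈ s, w k * x k i with hm
  have hm0 : ∀ i, 0 ≤ m i := fun i =>
    Finset.sum_nonneg fun k hk => mul_nonneg (hw k hk) (hx0 k i)
  have hle : ∀ j ∈ s, ∀ i, w j * x j i ≤ m i := fun j hj i =>
    Finset.single_le_sum (f := fun k => w k * x k i)
      (fun k hk => mul_nonneg (hw k hk) (hx0 k i)) hj
  -- Every `x j` is shrunk by the common factor `r i`, so the average becomes `min (m i) (z i)`. If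
  -- `m i = 0`, the value `r i = 0` given by division by zero is harmless.
  set r : ℕ → ℝ := fun i => min 1 (z i / m i) with hr
  have hr0 : ∀ i, 0 ≤ r i := fun i => le_min zero_le_one (div_nonneg (hz0 i) (hm0 i))
  have hr1 : ∀ i, r i ≤ 1 := fun i => min_le_left _ _
  -- At each coordinate either nothing is missing or nothing is removed, so deficit plus surplus is
  -- exactly the distance.
  have key : ∀ i, 0 ≤ z i - r i * m i ∧ (z i - r i * m i) + (1 - r i) * m i = |z i - m i| := by
    intro i
    rcases (hm0 i).eq_or_lt with h | h
    · rw [← h, mul_zero, mul_zero, sub_zero, add_zero, abs_of_nonneg (hz0 i)]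
      exact ⟨hz0 i, rfl⟩
    · rcases le_total (m i) (z i) with h' | h'
      · have : r i = 1 := min_eq_left ((one_le_div h).2 h')
        rw [this, abs_of_nonneg (sub_nonneg.2 h')]
        constructor <;> linarith
      · have h1 : r i = z i / m i := min_eq_right ((div_le_one h).2 h')
        have h2 : r i * m i = z i := by rw [h1, div_mul_cancel₀ _ h.ne']
        rw [abs_of_nonpos (sub_nonpos.2 h')]
        constructor <;> linarith
  have hus : ∀ j, Summable fun i => r i * x j i := fun j =>
    (hxs j).of_nonneg_of_le (fun i => mul_nonneg (hr0 i) (hx0 j i))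
      fun i => mul_le_of_le_one_left (hx0 j i) (hr1 i)
  set a : ι → ℝ := fun j => ∑' i, r i * x j i with ha
  have ha1 : ∀ j, a j ≤ 1 := fun j => ((hus j).tsum_le_tsum
    (fun i => mul_le_of_le_one_left (hx0 j i) (hr1 i)) (hxs j)).trans (hx1 j)
  have hrm : ∀ i, r i * m i = ∑ k ∈ s, w k * (r i * x k i) := fun i => by
    rw [hm, Finset.mul_sum]
    exact Finset.sum_congr rfl fun k _ => by ring
  have hrms : HasSum (fun i => r i * m i) (∑ k ∈ s, w k * a k) := by
    simp only [hrm]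
    exact hasSum_sum fun k _ => (hus k).hasSum.mul_left (w k)
  have hRs : HasSum (fun i => z i - r i * m i) (∑' i, z i - ∑ k ∈ s, w k * a k) :=
    hzs.hasSum.sub hrms
  set D : ℝ := ∑ k ∈ s, w k * (1 - a k) with hD
  have hDa : D = 1 - ∑ k ∈ s, w k * a k := by
    simp only [hD, mul_sub, mul_one, Finset.sum_sub_distrib, hw1]
  have hwa : ∀ j ∈ s, 0 ≤ w j * (1 - a j) := fun j hj =>
    mul_nonneg (hw j hj) (sub_nonneg.2 (ha1 j))
  have hD0 : 0 ≤ D := Finset.sum_nonneg hwa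
  -- The missing mass is shared in proportion to the room `1 - a j` left in each sequence. The total
  -- to add is at most the mean room `D` since `z` has mass at most one, so no sequence overflows.
  -- If `D = 0` that total is nonpositive and equal shares suffice.
  obtain ⟨θ, hθ0, hθw, hθ1, hθa⟩ : ∃ θ : ι → ℝ, (∀ j, 0 ≤ θ j) ∧ (∀ j ∈ s, w j * θ j ≤ 1) ∧
      ∑ j ∈ s, w j * θ j = 1 ∧ ∀ j, a j + θ j * (∑' i, z i - ∑ k ∈ s, w k * a k) ≤ 1 := by
    rcases hD0.eq_or_lt with h | h
    · refine ⟨fun _ => 1, fun _ => zero_le_one, fun j hj => ?_, by simpa using hw1, fun j => ?_⟩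
      · rw [mul_one, ← hw1]
        exact Finset.single_le_sum hw hj
      · have := ha1 j
        linarith
    · refine ⟨fun j => (1 - a j) / D, fun j => div_nonneg (sub_nonneg.2 (ha1 j)) h.le,
        fun j hj => ?_, ?_, fun j => ?_⟩
      · rw [← mul_div_assoc, div_le_one h]
        exact Finset.single_le_sum hwa hj
      · simp only [← mul_div_assoc]
        rw [← Finset.sum_div, div_self h.ne']
      · have h1 : (1 - a j) / D * (∑' i, z i - ∑ k ∈ s, w k * a k) ≤ (1 - a j) / D * D :=
          mul_le_mul_of_nonneg_left (by linarith) (div_nonneg (sub_nonneg.2 (ha1 j)) h.le)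
        rw [div_mul_cancel₀ _ h.ne'] at h1
        linarith
  have hys : ∀ j, HasSum (fun i => r i * x j i + θ j * (z i - r i * m i))
      (a j + θ j * (∑' i, z i - ∑ k ∈ s, w k * a k)) := fun j =>
    (hus j).hasSum.add (hRs.mul_left (θ j))
  refine ⟨fun j i => r i * x j i + θ j * (z i - r i * m i), fun j i => ?_,
    fun j => (hys j).summable, fun j => (hys j).tsum_eq.trans_le (hθa j), fun i => ?_,
    fun j hj i => ?_⟩
  · exact add_nonneg (mul_nonneg (hr0 i) (hx0 j i)) (mul_nonneg (hθ0 j) (key i).1)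
  · have : ∑ j ∈ s, w j * θ j * (z i - r i * m i) = z i - r i * m i := by
      rw [← Finset.sum_mul, hθ1, one_mul]
    simp only [mul_add, Finset.sum_add_distrib, ← mul_assoc]
    simp only [mul_assoc] at this ⊢
    rw [← hrm, this]
    ring
  · rw [← (key i).2]
    have h1 : |r i * x j i + θ j * (z i - r i * m i) - x j i|
        ≤ (1 - r i) * x j i + θ j * (z i - r i * m i) := by
      have h2 := mul_nonneg (sub_nonneg.2 (hr1 i)) (hx0 j i)
      have h3 := mul_nonneg (hθ0 j) (key i).1
      rw [abs_le]
      constructor <;> linarith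
    calc w j * |r i * x j i + θ j * (z i - r i * m i) - x j i|
        ≤ w j * ((1 - r i) * x j i + θ j * (z i - r i * m i)) :=
          mul_le_mul_of_nonneg_left h1 (hw j hj)
      _ = (w j * θ j) * (z i - r i * m i) + (1 - r i) * (w j * x j i) := by ring
      _ ≤ 1 * (z i - r i * m i) + (1 - r i) * m i :=
          add_le_add (mul_le_mul_of_nonneg_right (hθw j hj) (key i).1)
            (mul_le_mul_of_nonneg_left (hle j hj i) (sub_nonneg.2 (hr1 i)))
      _ = _ := by ring

end Sequences

/-! ### Transfer to `ℓ_p` and stability of the simplex. -/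

section Lift

variable {p : ℝ≥0∞}

theorem exists_mem_lpSimplex_of_nonneg_of_sum_le (hp : 1 ≤ p) {f : ℕ → ℝ} (h0 : ∀ i, 0 ≤ f i)
    (h1 : ∀ s : Finset ℕ, ∑ i ∈ s, f i ≤ 1) : ∃ x ∈ lpSimplex p, ∀ i, x i = f i := by
  have hs : Summable f := summable_of_sum_le h0 h1
  have hf : Memℓp (E := fun _ : ℕ => ℝ) f 1 := by
    refine memℓp_gen ?_
    simpa using hs.abs
  exact ⟨⟨f, hf.of_exponent_ge hp⟩, mem_lpSimplex_iff.2 ⟨h0, h1⟩, fun _ => rfl⟩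

theorem coeFn_finset_sum_smul {ι : Type*} (s : Finset ι) (w : ι → ℝ)
    (x : ι → lp (fun _ : ℕ => ℝ) p) (i : ℕ) :
    (∑ j ∈ s, w j • x j : lp (fun _ : ℕ => ℝ) p) i = ∑ j ∈ s, w j * x j i := by
  rw [lp.coeFn_sum, Finset.sum_apply]
  rfl

variable [Fact (1 ≤ p)]

/-- The estimate for sequences holds in every coordinate, and the `ℓ_p` norm is monotone in absolute
values of coordinates. The new sequences lie in `ℓ_p` because they are summable. -/
theorem exists_lpSimplex_sum_smul_eq {ι : Type*} (s : Finset ι) {w : ι → ℝ}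
    (hw : ∀ j ∈ s, 0 ≤ w j) (hw1 : ∑ j ∈ s, w j = 1) (x : ι → lpSimplex p) (z : lpSimplex p) :
    ∃ y : ι → lpSimplex p, ∑ j ∈ s, w j • (y j : lp (fun _ : ℕ => ℝ) p) = z ∧
      ∀ j ∈ s, w j * ‖(y j : lp (fun _ : ℕ => ℝ) p) - x j‖
        ≤ ‖(z : lp (fun _ : ℕ => ℝ) p) - ∑ k ∈ s, w k • (x k : lp (fun _ : ℕ => ℝ) p)‖ := by
  have hp1 : 1 ≤ p := Fact.out
  obtain ⟨y, hy0, hys, hy1, hyz, hyx⟩ := exists_sequences_sum_eq s hw hw1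
    (fun j => (x j).2.1) (fun j => (x j).2.2.1) (fun j => (x j).2.2.2) z.2.1 z.2.2.1 z.2.2.2
  choose u hu huy using fun j => exists_mem_lpSimplex_of_nonneg_of_sum_le hp1 (hy0 j)
    fun t => ((hys j).sum_le_tsum t fun i _ => hy0 j i).trans (hy1 j)
  refine ⟨fun j => ⟨u j, hu j⟩, ?_, fun j hj => ?_⟩
  · ext i
    rw [coeFn_finset_sum_smul]
    simp only [huy, hyz]
  · rw [← abs_of_nonneg (hw j hj), ← Real.norm_eq_abs, ← norm_smul]
    refine lp.norm_mono (zero_lt_one.trans_le hp1).ne' fun i => ?_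
    rw [lp.coeFn_sub, Pi.sub_apply, coeFn_finset_sum_smul, lp.coeFn_smul, Pi.smul_apply,
      norm_smul, Real.norm_eq_abs, abs_of_nonneg (hw j hj), lp.coeFn_sub, Pi.sub_apply, huy]
    exact hyx j hj i

/-- The midpoint map of the simplex is open. -/
theorem isOpenMap_midpointMap_lpSimplex : IsOpenMap (midpointMap (convex_lpSimplex p)) := by
  intro U hU
  rw [Metric.isOpen_iff]
  rintro _ ⟨q, hq, rfl⟩
  obtain ⟨ε, hε, hεU⟩ := Metric.isOpen_iff.1 hU q hq
  refine ⟨ε / 2, half_pos hε, fun z hz => ?_⟩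
  obtain ⟨y, hyz, hyx⟩ := exists_lpSimplex_sum_smul_eq (p := p) Finset.univ
    (w := fun _ : Bool => (1 / 2 : ℝ)) (by norm_num) (by norm_num) (fun b => cond b q.1 q.2) z
  have hd : ‖(z : lp (fun _ : ℕ => ℝ) p) - midpointMap (convex_lpSimplex p) q‖ < ε / 2 := by
    rw [← dist_eq_norm]
    exact hz
  have hmid : ∀ u v : lp (fun _ : ℕ => ℝ) p,
      (1 / 2 : ℝ) • u + (1 / 2 : ℝ) • v = (1 / 2 : ℝ) • (u + v) := fun u v => (smul_add _ _ _).symm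
  simp only [Fintype.sum_bool, cond_true, cond_false, hmid] at hyz hyx
  refine ⟨(y true, y false), hεU ?_, Subtype.ext hyz⟩
  have h1 := (hyx true (Finset.mem_univ _)).trans_lt hd
  have h2 := (hyx false (Finset.mem_univ _)).trans_lt hd
  rw [Metric.mem_ball, Prod.dist_eq, max_lt_iff, Subtype.dist_eq, Subtype.dist_eq, dist_eq_norm,
    dist_eq_norm]
  simp only [cond_true, cond_false] at h1 h2
  constructor <;> linarith

end Lift

/-! ### Integrals over the fibers of a simple function. -/

section Fibers

variable {α β E : Type*} [MeasurableSpace α] [NormedAddCommGroup E] [NormedSpace ℝ E]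

theorem MeasureTheory.SimpleFunc.integral_eq_sum_setIntegral_fiber (S : SimpleFunc α β)
    {μ : Measure α} {f : α → E} (hf : Integrable f μ) :
    ∫ a, f a ∂μ = ∑ j ∈ S.range, ∫ a in S ⁻¹' {j}, f a ∂μ := by
  classical
  have h : ⋃ j ∈ S.range, S ⁻¹' {j} = univ := by
    ext a
    simp
  rw [← setIntegral_univ, ← h]
  refine integral_biUnion_finset _ (fun j _ => S.measurableSet_fiber j) ?_
    fun j _ => hf.integrableOn
  exact fun i _ j _ hij => (disjoint_singleton.2 hij).preimage S

theorem MeasureTheory.SimpleFunc.setIntegral_fiber_comp [CompleteSpace E] (S : SimpleFunc α β)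
    (μ : Measure α) (x : β → E) (j : β) :
    ∫ a in S ⁻¹' {j}, x (S a) ∂μ = μ.real (S ⁻¹' {j}) • x j := by
  rw [setIntegral_congr_fun (S.measurableSet_fiber j) (g := fun _ => x j)
    (fun a ha => congrArg x ha), setIntegral_const]

end Fibers

/-! ### Weak convergence of image measures by dominated convergence. -/

section Pushforward

/-- If `T i → T` almost everywhere, then the images of `μ` under `T i` converge weakly to the
image of `μ` under `T`. -/
theorem MeasureTheory.ProbabilityMeasure.tendsto_map_of_ae_tendsto {Ω X ι : Type*}
    [MeasurableSpace Ω] [TopologicalSpace X] [MeasurableSpace X] [OpensMeasurableSpace X]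
    {l : Filter ι} [l.IsCountablyGenerated] (μ : ProbabilityMeasure Ω) {T : ι → Ω → X}
    {T₀ : Ω → X} (hT : ∀ i, Measurable (T i)) (hT₀ : Measurable T₀)
    (h : ∀ᵐ ω ∂(μ : Measure Ω), Filter.Tendsto (fun i => T i ω) l (nhds (T₀ ω))) :
    Filter.Tendsto (fun i => μ.map (hT i).aemeasurable) l (nhds (μ.map hT₀.aemeasurable)) := by
  rw [ProbabilityMeasure.tendsto_iff_forall_integral_tendsto]
  intro f
  have hf : StronglyMeasurable f := f.continuous.stronglyMeasurable
  have hmap : ∀ {g : Ω → X} (hg : Measurable g),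
      ∫ x, f x ∂((μ.map hg.aemeasurable : ProbabilityMeasure X) : Measure X)
        = ∫ ω, f (g ω) ∂(μ : Measure Ω) := fun hg => by
    rw [ProbabilityMeasure.toMeasure_map]
    exact integral_map hg.aemeasurable hf.aestronglyMeasurable
  refine Filter.Tendsto.congr (fun i => (hmap (hT i)).symm) ?_
  rw [hmap hT₀]
  refine tendsto_integral_filter_of_dominated_convergence (fun _ => ‖f‖)
    (Filter.Eventually.of_forall fun i => (hf.comp_measurable (hT i)).aestronglyMeasurable)
    (Filter.Eventually.of_forall fun i => Filter.Eventually.of_forall fun ω => f.norm_coe_le_norm _)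
    (integrable_const _) ?_
  filter_upwards [h] with ω hω
  exact (f.continuous.tendsto _).comp hω

end Pushforward

/-! ### Approximation by finitely supported measures with the same barycenter. -/

section Barycenter

variable {E : Type*} [NormedAddCommGroup E] [NormedSpace ℝ E] [MeasurableSpace E]

theorem barycenterMap_eq_of_isBarycenter {B A : Set E}
    (h : ∀ μ : ProbabilityMeasure B, ∃ x ∈ A, IsBarycenter μ x) {μ : ProbabilityMeasure B} {x : A}
    (hx : IsBarycenter μ (x : E)) : barycenterMap B A h μ = x :=
  Subtype.ext ((isBarycenter_barycenterMap h μ).unique hx)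

variable [BorelSpace E]

omit [NormedSpace ℝ E] in
theorem integrable_coe_of_isBounded_of_isSeparable {Ω : Type*} [MeasurableSpace Ω] {A : Set E}
    (hbd : Bornology.IsBounded A) (hsep : IsSeparable A) (μ : Measure Ω) [IsFiniteMeasure μ]
    {g : Ω → A} (hg : Measurable g) : Integrable (fun ω => (g ω : E)) μ := by
  obtain ⟨C, hC⟩ := hbd.exists_norm_le
  have hsm : StronglyMeasurable (fun ω => (g ω : E)) := by
    refine stronglyMeasurable_iff_measurable_separable.2 ⟨measurable_subtype_coe.comp hg, ?_⟩
    refine hsep.mono ?_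
    rintro _ ⟨ω, rfl⟩
    exact (g ω).2
  exact Integrable.of_bound hsm.aestronglyMeasurable C
    (Filter.Eventually.of_forall fun ω => hC _ (g ω).2)

variable [CompleteSpace E]

theorem isBarycenter_map_integral {Ω : Type*} [MeasurableSpace Ω] {A : Set E}
    (hbd : Bornology.IsBounded A) (hsep : IsSeparable A) (μ : ProbabilityMeasure Ω)
    {g : Ω → A} (hg : Measurable g) :
    IsBarycenter (μ.map hg.aemeasurable) (∫ ω, (g ω : E) ∂(μ : Measure Ω)) := by
  intro φ
  have hint : Integrable (fun y : A => φ (y : E))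
      ((μ.map hg.aemeasurable : ProbabilityMeasure A) : Measure A) :=
    φ.integrable_comp (integrable_coe_of_isBounded_of_isSeparable hbd hsep _ measurable_id)
  refine ⟨hint, ?_⟩
  rw [ProbabilityMeasure.toMeasure_map] at hint ⊢
  rw [integral_map hg.aemeasurable hint.aestronglyMeasurable]
  exact φ.integral_comp_comm (integrable_coe_of_isBounded_of_isSeparable hbd hsep _ hg)

/-- Replacing the values of a simple function `S` by the averages over its fibers gives a function
with the same integral as the identity, whose mean distance to `S` is at most that of the identity. -/
theorem exists_fiber_averages {A : Set E} (hconv : Convex ℝ A) (hcl : IsClosed A)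
    (hbd : Bornology.IsBounded A) (hsep : IsSeparable A) (μ : ProbabilityMeasure A)
    (S : SimpleFunc A A) :
    ∃ x : A → A, ∫ y, (x (S y) : E) ∂(μ : Measure A) = ∫ y, (y : E) ∂(μ : Measure A) ∧
      ∫ y, ‖(x (S y) : E) - S y‖ ∂(μ : Measure A) ≤ ∫ y, ‖(y : E) - S y‖ ∂(μ : Measure A) := by
  have hid : Integrable (fun y : A => (y : E)) (μ : Measure A) :=
    integrable_coe_of_isBounded_of_isSeparable hbd hsep _ measurable_id
  have hcomp : ∀ x : A → A, Integrable (fun y : A => (x (S y) : E)) (μ : Measure A) := fun x =>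
    integrable_coe_of_isBounded_of_isSeparable hbd hsep _ (S.map x).measurable
  have hx : ∀ j : A, ∃ x : A, (μ : Measure A).real (S ⁻¹' {j}) • (x : E)
      = ∫ y in S ⁻¹' {j}, (y : E) ∂(μ : Measure A) := by
    intro j
    by_cases h0 : (μ : Measure A) (S ⁻¹' {j}) = 0
    -- On a null fiber both sides vanish and any point of `A` would do.
    · refine ⟨j, ?_⟩
      rw [measureReal_def, h0, ENNReal.toReal_zero, zero_smul, Measure.restrict_eq_zero.2 h0,
        integral_zero_measure]
    · refine ⟨⟨⨍ y in S ⁻¹' {j}, (y : E) ∂(μ : Measure A), ?_⟩, ?_⟩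
      · exact hconv.set_average_mem hcl h0 (measure_ne_top _ _)
          (Filter.Eventually.of_forall fun y => y.2) hid.integrableOn
      · exact measure_smul_setAverage _ (measure_ne_top _ _)
  choose x hx using hx
  refine ⟨x, ?_, ?_⟩
  · rw [S.integral_eq_sum_setIntegral_fiber (hcomp x), S.integral_eq_sum_setIntegral_fiber hid]
    refine Finset.sum_congr rfl fun j _ => ?_
    rw [S.setIntegral_fiber_comp _ (fun j => (x j : E)), hx]
  · have hS : Integrable (fun y : A => (S y : E)) (μ : Measure A) := hcomp id
    refine (S.integral_eq_sum_setIntegral_fiber ((hcomp x).sub hS).norm).trans_le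
      (le_of_le_of_eq ?_ (S.integral_eq_sum_setIntegral_fiber (hid.sub hS).norm).symm)
    refine Finset.sum_le_sum fun j _ => ?_
    have h1 := S.setIntegral_fiber_comp (μ : Measure A) (fun j => ‖(x j : E) - j‖) j
    have h2 := S.setIntegral_fiber_comp (μ : Measure A) (fun j => (j : E)) j
    simp only [Pi.sub_apply] at h1 h2 ⊢
    rw [h1, smul_eq_mul, ← abs_of_nonneg (measureReal_nonneg (μ := (μ : Measure A))),
      ← Real.norm_eq_abs, ← norm_smul, smul_sub, hx, ← h2,
      ← integral_sub hid.integrableOn hS.integrableOn]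
    exact norm_integral_le_integral_norm _

/-- A probability measure on `A` is a weak limit of finitely supported probability measures with
the same barycenter. -/
theorem exists_simpleFunc_map_mem_nhds {A : Set E} (hconv : Convex ℝ A) (hcl : IsClosed A)
    (hbd : Bornology.IsBounded A) (hsep : IsSeparable A) (μ : ProbabilityMeasure A)
    {U : Set (ProbabilityMeasure A)} (hU : U ∈ nhds μ) :
    ∃ (S : SimpleFunc A A) (x : A → A), μ.map (S.map x).aemeasurable ∈ U ∧
      ∫ y, (x (S y) : E) ∂(μ : Measure A) = ∫ y, (y : E) ∂(μ : Measure A) := by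
  have : SeparableSpace A := hsep.separableSpace
  obtain ⟨a⟩ := μ.nonempty
  have hid : Integrable (fun y : A => (y : E)) (μ : Measure A) :=
    integrable_coe_of_isBounded_of_isSeparable hbd hsep _ measurable_id
  set S : ℕ → SimpleFunc A A := fun n =>
    SimpleFunc.approxOn id measurable_id univ a (mem_univ a) n with hS
  have hSint : ∀ n, Integrable (fun y => (S n y : E)) (μ : Measure A) := fun n =>
    integrable_coe_of_isBounded_of_isSeparable hbd hsep _ (S n).measurable
  have hlim : ∀ y : A, Filter.Tendsto (fun n => S n y) Filter.atTop (nhds y) := fun y =>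
    SimpleFunc.tendsto_approxOn measurable_id (mem_univ a) (by simp)
  choose x hxint hxS using fun n => exists_fiber_averages hconv hcl hbd hsep μ (S n)
  have hxSint : ∀ n, Integrable (fun y => (x n (S n y) : E)) (μ : Measure A) := fun n =>
    integrable_coe_of_isBounded_of_isSeparable hbd hsep _ ((S n).map (x n)).measurable
  obtain ⟨C, hC⟩ := hbd.exists_norm_le
  have hL1 : Filter.Tendsto (fun n => ∫ y, ‖(y : E) - S n y‖ ∂(μ : Measure A)) Filter.atTop
      (nhds 0) := by
    have := tendsto_integral_of_dominated_convergence (μ := (μ : Measure A))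
      (F := fun n y => ‖(y : E) - S n y‖) (f := fun _ => 0) (fun _ => C + C)
      (fun n => (hid.sub (hSint n)).norm.aestronglyMeasurable) (integrable_const _)
      (fun n => Filter.Eventually.of_forall fun y => by
        rw [norm_norm]
        exact (norm_sub_le _ _).trans (add_le_add (hC _ y.2) (hC _ (S n y).2)))
      (Filter.Eventually.of_forall fun y => by
        have h := (continuous_subtype_val.tendsto y).comp (hlim y)
        simpa using ((tendsto_const_nhds (x := (y : E))).sub h).norm)
    simpa using this
  -- Averaging over fibers costs at most the error of `S n` a second time, so the averaged maps
  -- still tend to the identity in mean.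
  have hL1' : Filter.Tendsto (fun n => ∫ y, ‖(x n (S n y) : E) - y‖ ∂(μ : Measure A)) Filter.atTop
      (nhds 0) := by
    refine squeeze_zero (fun n => integral_nonneg fun y => norm_nonneg _) (fun n => ?_)
      (by simpa using hL1.add hL1)
    refine le_trans ?_ (add_le_add_left (hxS n) _)
    refine le_of_le_of_eq ?_
      (integral_add ((hxSint n).sub (hSint n)).norm (hid.sub (hSint n)).norm)
    refine integral_mono ((hxSint n).sub hid).norm
      (((hxSint n).sub (hSint n)).norm.add (hid.sub (hSint n)).norm) fun y => ?_
    have := norm_sub_le_norm_sub_add_norm_sub (x n (S n y) : E) (S n y) y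
    rwa [norm_sub_rev (S n y : E) y] at this
  have hmeas : TendstoInMeasure (μ : Measure A) (fun n y => (x n (S n y) : E)) Filter.atTop
      fun y => (y : E) := by
    refine tendstoInMeasure_of_tendsto_eLpNorm one_ne_zero
      (fun n => (hxSint n).aestronglyMeasurable) hid.aestronglyMeasurable ?_
    have h : ∀ n, eLpNorm ((fun y => (x n (S n y) : E)) - fun y : A => (y : E)) 1 (μ : Measure A)
        = ENNReal.ofReal (∫ y, ‖(x n (S n y) : E) - y‖ ∂(μ : Measure A)) := fun n => by
      rw [eLpNorm_one_eq_lintegral_enorm]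
      exact (ofReal_integral_norm_eq_lintegral_enorm ((hxSint n).sub hid)).symm
    simp only [h]
    simpa [Function.comp_def] using (ENNReal.continuous_ofReal.tendsto 0).comp hL1'
  -- Along a subsequence the convergence is almost everywhere, which yields weak convergence of the
  -- images to `μ`.
  obtain ⟨ns, -, hns⟩ := hmeas.exists_seq_tendsto_ae
  have hw := ProbabilityMeasure.tendsto_map_of_ae_tendsto μ (l := Filter.atTop)
    (T := fun k => (S (ns k)).map (x (ns k))) (T₀ := id)
    (fun k => ((S (ns k)).map (x (ns k))).measurable) measurable_id (by
      filter_upwards [hns] with y hy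
      exact tendsto_subtype_rng.2 hy)
  have hmapid : μ.map measurable_id.aemeasurable = μ := by
    apply ProbabilityMeasure.toMeasure_injective
    rw [ProbabilityMeasure.toMeasure_map, Measure.map_id]
  rw [hmapid] at hw
  obtain ⟨k, hk⟩ := (hw.eventually hU).exists
  exact ⟨S (ns k), x (ns k), hk, hxint _⟩

end Barycenter

/-! ### Openness of the barycenter map on all measures. -/

section Open

variable {p : ℝ≥0∞} [Fact (1 ≤ p)]
  [MeasurableSpace (lp (fun _ : ℕ => ℝ) p)] [BorelSpace (lp (fun _ : ℕ => ℝ) p)]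

/-- Near `μ` there is a finitely supported measure with the same barycenter. Its atoms are moved so
that the barycenter becomes any prescribed nearby `z`; as `z` returns to the barycenter of `μ`, the
moved measures converge weakly. -/
theorem isOpenMap_barycenterMap_lpSimplex (hp : p ≠ ∞) :
    IsOpenMap (barycenterMap (lpSimplex p) (lpSimplex p) (exists_isBarycenter_lpSimplex p hp)) := by
  have hbd := isBounded_lpSimplex p hp
  have hsep := isSeparable_lpSimplex p hp
  rw [isOpenMap_iff_nhds_le]
  intro μ V hV
  rw [Filter.mem_map] at hV
  -- The interior is needed because the perturbed measures approach the finitely supported one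
  -- rather than `μ`.
  obtain ⟨S, x, hxU, hxint⟩ := exists_simpleFunc_map_mem_nhds (convex_lpSimplex p)
    (isClosed_lpSimplex p) hbd hsep μ
    (interior_mem_nhds.2 hV)
  set m := (μ : Measure (lpSimplex p))
  set b := barycenterMap (lpSimplex p) (lpSimplex p) (exists_isBarycenter_lpSimplex p hp)
  set w : lpSimplex p → ℝ := fun j => m.real (S ⁻¹' {j}) with hw
  have hint : ∀ y : lpSimplex p → lpSimplex p,
      Integrable (fun ω => (y (S ω) : lp (fun _ : ℕ => ℝ) p)) m := fun y =>
    integrable_coe_of_isBounded_of_isSeparable hbd hsep _ (S.map y).measurable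
  have hsum : ∀ y : lpSimplex p → lpSimplex p, ∫ ω, (y (S ω) : lp (fun _ : ℕ => ℝ) p) ∂m
      = ∑ j ∈ S.range, w j • (y j : lp (fun _ : ℕ => ℝ) p) := fun y => by
    rw [S.integral_eq_sum_setIntegral_fiber (hint y)]
    exact Finset.sum_congr rfl fun j _ =>
      S.setIntegral_fiber_comp m (fun j => (y j : lp (fun _ : ℕ => ℝ) p)) j
  have hw1 : ∑ j ∈ S.range, w j = 1 := by
    have h := S.integral_eq_sum_setIntegral_fiber (μ := m) (integrable_const (1 : ℝ))
    simpa using h.symm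
  have hbx : (b μ : lp (fun _ : ℕ => ℝ) p)
      = ∑ k ∈ S.range, w k • (x k : lp (fun _ : ℕ => ℝ) p) := by
    rw [← hsum, hxint]
    refine (isBarycenter_barycenterMap _ μ).unique ?_
    have h := isBarycenter_map_integral hbd hsep μ measurable_id
    have hmapid : μ.map measurable_id.aemeasurable = μ := by
      apply ProbabilityMeasure.toMeasure_injective
      rw [ProbabilityMeasure.toMeasure_map, Measure.map_id]
    rwa [hmapid] at h
  choose y hyz hyx using fun z : lpSimplex p => exists_lpSimplex_sum_smul_eq S.range (w := w)
    (fun j _ => measureReal_nonneg) hw1 x z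
  have hlim : ∀ j ∈ S.range, w j ≠ 0 → Filter.Tendsto (fun z => y z j) (nhds (b μ))
      (nhds (x j)) := by
    intro j hj hj0
    have hpos : 0 < w j := lt_of_le_of_ne measureReal_nonneg hj0.symm
    rw [tendsto_iff_dist_tendsto_zero]
    have h0 : Filter.Tendsto (fun z : lpSimplex p => (w j)⁻¹ * dist z (b μ)) (nhds (b μ))
        (nhds 0) := by
      have : Continuous fun z : lpSimplex p => (w j)⁻¹ * dist z (b μ) := by fun_prop
      simpa using this.tendsto (b μ)
    refine squeeze_zero (fun z => dist_nonneg) (fun z => ?_) h0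
    rw [Subtype.dist_eq, Subtype.dist_eq, dist_eq_norm, dist_eq_norm, hbx, ← div_eq_inv_mul,
      le_div_iff₀' hpos]
    exact hyx z j hj
  have hae : ∀ᵐ ω ∂m, Filter.Tendsto (fun z => S.map (y z) ω) (nhds (b μ))
      (nhds (S.map x ω)) := by
    -- Atoms of weight zero are not controlled by the weighted estimate, but their fibers are
    -- finitely many null sets.
    have h : ∀ᵐ ω ∂m, ∀ j ∈ S.range, S ω = j → w j ≠ 0 := by
      rw [Finset.eventually_all]
      intro j _
      by_cases hj : w j = 0
      · have : m (S ⁻¹' {j}) = 0 := by simpa [hw, measureReal_eq_zero_iff] using hj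
        filter_upwards [measure_eq_zero_iff_ae_notMem.1 this] with ω hω hω'
        exact absurd hω' hω
      · exact Filter.Eventually.of_forall fun _ _ => hj
    filter_upwards [h] with ω hω
    exact hlim _ (S.mem_range_self ω) (hω _ (S.mem_range_self ω) rfl)
  have hconv := ProbabilityMeasure.tendsto_map_of_ae_tendsto μ
    (fun z => (S.map (y z)).measurable) (S.map x).measurable hae
  have hVU : ∀ᶠ z in nhds (b μ), μ.map (S.map (y z)).aemeasurable ∈ b ⁻¹' V :=
    (hconv.eventually (isOpen_interior.mem_nhds hxU)).mono fun _ h => interior_subset h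
  filter_upwards [hVU] with z hz
  have hbz : b (μ.map (S.map (y z)).aemeasurable) = z := by
    refine barycenterMap_eq_of_isBarycenter _ ?_
    have h := isBarycenter_map_integral hbd hsep μ (S.map (y z)).measurable
    simp only [SimpleFunc.map_apply] at h
    rwa [hsum, hyz] at h
  have h : b (μ.map (S.map (y z)).aemeasurable) ∈ V := hz
  rwa [hbz] at h

end Open

/-! ### Tail sums and total boundedness. -/

section Tails

variable {p : ℝ≥0∞} [Fact (1 ≤ p)]

/-- The triangle inequality for the expansion in unit vectors, each of norm one. -/
theorem norm_sub_sum_single_le_tsum (hp : p ≠ ∞) {y : lp (fun _ : ℕ => ℝ) p}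
    (hy : y ∈ lpSimplex p) (n : ℕ) :
    ‖y - ∑ i ∈ Finset.range n, lp.single (E := fun _ : ℕ => ℝ) p i (y i)‖ ≤ ∑' i, y (i + n) := by
  have hp0 : 0 < p := zero_lt_one.trans_le Fact.out
  have h := lp.hasSum_single hp y
  have hs : HasSum (fun i => lp.single (E := fun _ : ℕ => ℝ) p (i + n) (y (i + n)))
      (y - ∑ i ∈ Finset.range n, lp.single (E := fun _ : ℕ => ℝ) p i (y i)) :=
    (hasSum_nat_add_iff' n).2 h
  rw [← hs.tsum_eq]
  refine tsum_of_norm_bounded ((summable_nat_add_iff n).2 hy.2.1).hasSum fun i => ?_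
  rw [lp.norm_single hp0, Real.norm_of_nonneg (hy.1 _)]

theorem norm_le_tsum_of_mem_lpSimplex (hp : p ≠ ∞) {y : lp (fun _ : ℕ => ℝ) p}
    (hy : y ∈ lpSimplex p) : ‖y‖ ≤ ∑' i, y i := by
  simpa using norm_sub_sum_single_le_tsum hp hy 0

/-- A set of points of the simplex with uniformly small tails is totally bounded. -/
theorem totallyBounded_setOf_tsum_tail_le (hp : p ≠ ∞) (n : ℕ → ℕ) :
    TotallyBounded {y : lp (fun _ : ℕ => ℝ) p |
      y ∈ lpSimplex p ∧ ∀ k : ℕ, ∑' i, y (i + n k) ≤ 1 / ((k : ℝ) + 1)} := by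
  rw [Metric.totallyBounded_iff]
  intro ε hε
  obtain ⟨k, hk⟩ := exists_nat_one_div_lt (half_pos hε)
  -- Truncation at `n k` moves points of the set by less than `ε / 2` and lands in the compact image
  -- of a cube, so an `ε / 2`-net there suffices.
  set F : (ℕ → ℝ) → lp (fun _ : ℕ => ℝ) p := fun c =>
    ∑ i ∈ Finset.range (n k), lp.single (E := fun _ : ℕ => ℝ) p i (c i) with hF
  have hFc : Continuous F := continuous_finsetSum _ fun i _ =>
    (lp.isometry_single (E := fun _ : ℕ => ℝ) (p := p) i).continuous.comp (continuous_apply i)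
  have hC : IsCompact (F '' Set.pi univ fun _ => Icc 0 1) :=
    (isCompact_univ_pi fun _ => isCompact_Icc).image hFc
  obtain ⟨t, ht, htC⟩ := Metric.totallyBounded_iff.1 hC.totallyBounded (ε / 2) (half_pos hε)
  refine ⟨t, ht, fun y hy => ?_⟩
  have hyF : F y ∈ F '' Set.pi univ fun _ => Icc 0 1 := by
    refine mem_image_of_mem _ fun i _ => ⟨hy.1.1 i, ?_⟩
    simpa using (mem_lpSimplex_iff.1 hy.1).2 {i}
  obtain ⟨c, hc, hcy⟩ := mem_iUnion₂.1 (htC hyF)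
  refine mem_iUnion₂.2 ⟨c, hc, ?_⟩
  have h1 : dist y (F y) < ε / 2 := by
    rw [dist_eq_norm]
    exact ((norm_sub_sum_single_le_tsum hp hy.1 (n k)).trans (hy.2 k)).trans_lt hk
  have h2 := dist_triangle y (F y) c
  rw [Metric.mem_ball] at hcy ⊢
  linarith

end Tails

/-! ### Pointwise compactness through tightness. -/

section Compactness

variable {p : ℝ≥0∞} [Fact (1 ≤ p)]
  [MeasurableSpace (lp (fun _ : ℕ => ℝ) p)] [BorelSpace (lp (fun _ : ℕ => ℝ) p)]

theorem measurable_lpSimplex_coord (i : ℕ) :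
    Measurable fun y : lpSimplex p => (y : lp (fun _ : ℕ => ℝ) p) i :=
  ((lp.evalCLM ℝ (fun _ : ℕ => ℝ) p i).continuous.comp continuous_subtype_val).measurable

/-- Tonelli's theorem, with the barycenter identity applied to each coordinate functional. The right
side depends on `μ` only through `x`, which gives the uniformity needed for tightness. -/
theorem lintegral_tsum_tail_eq {μ : ProbabilityMeasure (lpSimplex p)}
    {x : lp (fun _ : ℕ => ℝ) p} (hx : IsBarycenter μ x) (n : ℕ) :
    ∫⁻ y : lpSimplex p, ∑' i, ENNReal.ofReal ((y : lp (fun _ : ℕ => ℝ) p) (i + n))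
      ∂(μ : Measure (lpSimplex p)) = ∑' i, ENNReal.ofReal (x (i + n)) := by
  rw [lintegral_tsum fun i => (measurable_lpSimplex_coord _).ennreal_ofReal.aemeasurable]
  refine tsum_congr fun i => ?_
  obtain ⟨hint, heq⟩ := hx (lp.evalCLM ℝ (fun _ : ℕ => ℝ) p (i + n))
  exact (ofReal_integral_eq_lintegral_ofReal hint
    (Filter.Eventually.of_forall fun y : lpSimplex p => y.2.1 (i + n))).symm.trans
    (congrArg ENNReal.ofReal heq)

theorem isTightMeasureSet_measuresWithBarycenter_lpSimplex (hp : p ≠ ∞)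
    {x : lp (fun _ : ℕ => ℝ) p} (hx : x ∈ lpSimplex p) :
    IsTightMeasureSet {((μ : ProbabilityMeasure (lpSimplex p)) : Measure (lpSimplex p)) |
      μ ∈ measuresWithBarycenter (lpSimplex p) x} := by
  rw [isTightMeasureSet_iff_exists_isCompact_measure_compl_le]
  intro ε hε
  obtain ⟨δ, hδ0, hδ⟩ := ENNReal.exists_pos_sum_of_countable' hε.ne' ℕ
  have hc0 : ∀ k : ℕ, ENNReal.ofReal (1 / ((k : ℝ) + 1)) ≠ 0 := fun k =>
    (ENNReal.ofReal_pos.2 Nat.one_div_pos_of_nat).ne'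
  have hxfin : ∑' i, ENNReal.ofReal (x i) ≠ ∞ := by
    rw [← ENNReal.ofReal_tsum_of_nonneg hx.1 hx.2.1]
    exact ENNReal.ofReal_ne_top
  -- With this choice Markov's inequality bounds by `δ k` the measure of the points whose tail from
  -- `n k` is at least `1 / (k + 1)`.
  have hn : ∀ k : ℕ, ∃ n, ∑' i, ENNReal.ofReal (x (i + n))
      ≤ δ k * ENNReal.ofReal (1 / ((k : ℝ) + 1)) := fun k =>
    ((ENNReal.tendsto_sum_nat_add _ hxfin).eventually_le_const
      (pos_iff_ne_zero.2 (mul_ne_zero (hδ0 k).ne' (hc0 k)))).exists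
  choose n hn using hn
  set K := {y : lp (fun _ : ℕ => ℝ) p |
    y ∈ lpSimplex p ∧ ∀ k : ℕ, ∑' i, y (i + n k) ≤ 1 / ((k : ℝ) + 1)} with hK
  refine ⟨Subtype.val ⁻¹' closure K, ?_, ?_⟩
  · exact (isClosed_lpSimplex p).isClosedEmbedding_subtypeVal.isCompact_preimage
      (isCompact_iff_totallyBounded_isComplete.2
        ⟨(totallyBounded_setOf_tsum_tail_le hp n).closure, isClosed_closure.isComplete⟩)
  · rintro _ ⟨μ, hμ, rfl⟩
    set τ : ℕ → lpSimplex p → ℝ≥0∞ := fun k y =>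
      ∑' i, ENNReal.ofReal ((y : lp (fun _ : ℕ => ℝ) p) (i + n k)) with hτ
    have hτm : ∀ k, Measurable (τ k) := fun k =>
      Measurable.tsum fun i => (measurable_lpSimplex_coord _).ennreal_ofReal
    have hsub : (Subtype.val ⁻¹' closure K : Set (lpSimplex p))ᶜ
        ⊆ ⋃ k : ℕ, {y | ENNReal.ofReal (1 / ((k : ℝ) + 1)) ≤ τ k y} := by
      intro y hy
      by_contra h
      simp only [mem_iUnion, mem_ofPred_eq, not_exists, not_le] at h
      refine hy (subset_closure ⟨y.2, fun k => ?_⟩)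
      have h1 := h k
      simp only [hτ] at h1
      rw [← ENNReal.ofReal_tsum_of_nonneg (fun i => y.2.1 _)
        ((summable_nat_add_iff (n k)).2 y.2.2.1)] at h1
      exact (ENNReal.ofReal_lt_ofReal_iff Nat.one_div_pos_of_nat).1 h1 |>.le
    calc (μ : Measure (lpSimplex p)) (Subtype.val ⁻¹' closure K)ᶜ
        ≤ ∑' k : ℕ, (μ : Measure (lpSimplex p)) {y | ENNReal.ofReal (1 / ((k : ℝ) + 1)) ≤ τ k y} :=
          (measure_mono hsub).trans (measure_iUnion_le _)
      _ ≤ ∑' k, δ k := by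
          refine ENNReal.tsum_le_tsum fun k => ?_
          refine (meas_ge_le_lintegral_div (hτm k).aemeasurable (hc0 k)
            ENNReal.ofReal_ne_top).trans ?_
          rw [lintegral_tsum_tail_eq hμ]
          exact ENNReal.div_le_of_le_mul (hn k)
      _ ≤ ε := hδ.le

/-- Continuous functionals are bounded on the simplex, so each barycenter equation is a closed
condition in the weak topology. -/
theorem isClosed_measuresWithBarycenter_lpSimplex (hp : p ≠ ∞) (x : lp (fun _ : ℕ => ℝ) p) :
    IsClosed (measuresWithBarycenter (lpSimplex p) x) := by
  obtain ⟨C, hC⟩ := (isBounded_lpSimplex p hp).exists_norm_le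
  have hφ : ∀ φ : lp (fun _ : ℕ => ℝ) p →L[ℝ] ℝ, ∀ y : lpSimplex p, ‖φ y‖ ≤ ‖φ‖ * C :=
    fun φ y => (φ.le_opNorm _).trans (mul_le_mul_of_nonneg_left (hC _ y.2) (norm_nonneg _))
  have heq : measuresWithBarycenter (lpSimplex p) x = ⋂ φ : lp (fun _ : ℕ => ℝ) p →L[ℝ] ℝ,
      {μ : ProbabilityMeasure (lpSimplex p) |
        ∫ y : lpSimplex p, φ y ∂(μ : Measure (lpSimplex p)) = φ x} := by
    ext μ
    rw [mem_iInter]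
    exact ⟨fun h φ => (h φ).2, fun h φ => ⟨φ.integrable_comp
      (integrable_coe_of_isBounded_of_isSeparable (isBounded_lpSimplex p hp)
        (isSeparable_lpSimplex p hp) _ measurable_id), h φ⟩⟩
  rw [heq]
  refine isClosed_iInter fun φ => isClosed_eq ?_ continuous_const
  exact ProbabilityMeasure.continuous_integral_boundedContinuousFunction
    (BoundedContinuousFunction.ofNormedAddCommGroup (fun y : lpSimplex p => φ y)
      (φ.continuous.comp continuous_subtype_val) _ (hφ φ))

theorem pointwiseMuCompact_lpSimplex (hp : p ≠ ∞) : PointwiseMuCompact (lpSimplex p) := by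
  intro x hx
  rw [(convex_lpSimplex p).convexHull_eq, (isClosed_lpSimplex p).closure_eq] at hx
  have h := isCompact_closure_of_isTightMeasureSet
    (isTightMeasureSet_measuresWithBarycenter_lpSimplex hp hx)
  rwa [(isClosed_measuresWithBarycenter_lpSimplex hp x).closure_eq] at h

end Compactness

/-! ### Extreme points and averages of unit vectors. -/

section Vertices

variable {p : ℝ≥0∞}

theorem zero_mem_lpSimplex : (0 : lp (fun _ : ℕ => ℝ) p) ∈ lpSimplex p :=
  mem_lpSimplex_iff.2 ⟨fun _ => le_rfl, fun s => by simp⟩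

theorem single_one_mem_lpSimplex (i : ℕ) :
    lp.single (E := fun _ : ℕ => ℝ) p i (1 : ℝ) ∈ lpSimplex p := by
  classical
  rw [mem_lpSimplex_iff]
  simp only [lp.coeFn_single]
  refine ⟨fun j => ?_, fun s => ?_⟩
  · rw [Pi.single_apply]
    split_ifs <;> norm_num
  · simp only [Pi.single_apply]
    rw [Finset.sum_ite_eq']
    split_ifs <;> norm_num

theorem zero_mem_extremePoints_lpSimplex :
    (0 : lp (fun _ : ℕ => ℝ) p) ∈ extremePoints ℝ (lpSimplex p) := by
  refine mem_extremePoints_iff_left.2 ⟨zero_mem_lpSimplex, ?_⟩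
  rintro u hu v hv ⟨a, b, ha, hb, -, h⟩
  ext i
  have hi : a * u i + b * v i = 0 := congrArg (fun x : lp (fun _ : ℕ => ℝ) p => x i) h
  have h1 := mul_nonneg ha.le (hu.1 i)
  have h2 := mul_nonneg hb.le (hv.1 i)
  have h3 : a * u i = 0 := by linarith
  exact (mul_eq_zero.1 h3).resolve_left ha.ne'

/-- If `0 < x i < 1`, then `x` is a proper convex combination of the `i`-th unit vector and the rest
of `x` rescaled by `1 / (1 - x i)`, which still has mass at most one. -/
theorem eq_zero_or_one_of_mem_extremePoints_lpSimplex {x : lp (fun _ : ℕ => ℝ) p}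
    (hx : x ∈ extremePoints ℝ (lpSimplex p)) (i : ℕ) : x i = 0 ∨ x i = 1 := by
  classical
  obtain ⟨hxm, hx⟩ := mem_extremePoints_iff_left.1 hx
  obtain ⟨hx0, hx1⟩ := mem_lpSimplex_iff.1 hxm
  by_contra! hne
  have hpos : 0 < x i := (hx0 i).lt_of_ne' hne.1
  have hlt : x i < 1 := lt_of_le_of_ne (by simpa using hx1 {i}) hne.2
  have hlt' : 0 < 1 - x i := sub_pos.2 hlt
  set e := lp.single (E := fun _ : ℕ => ℝ) p i (1 : ℝ) with he
  set v : lp (fun _ : ℕ => ℝ) p := (1 - x i)⁻¹ • (x - x i • e) with hv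
  have hvj : ∀ j, v j = (1 - x i)⁻¹ * (if j = i then 0 else x j) := fun j => by
    have h1 : v j = (1 - x i)⁻¹ * (x j - x i * e j) := rfl
    rw [h1, he, lp.coeFn_single, Pi.single_apply]
    split_ifs with h
    · rw [h, mul_one, sub_self]
    · rw [mul_zero, sub_zero]
  have hvm : v ∈ lpSimplex p := by
    rw [mem_lpSimplex_iff]
    refine ⟨fun j => ?_, fun s => ?_⟩
    · rw [hvj]
      refine mul_nonneg (inv_nonneg.2 hlt'.le) ?_
      split_ifs
      exacts [le_rfl, hx0 j]
    · simp only [hvj]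
      rw [← Finset.mul_sum, inv_mul_le_one₀ hlt', le_sub_iff_add_le']
      refine le_trans (le_of_eq ?_) (hx1 (insert i (s.erase i)))
      rw [Finset.sum_insert (Finset.notMem_erase i s)]
      congr 1
      simp only [← ite_not (_ = i), ← Finset.sum_filter, Finset.filter_ne']
  have h := hx e (single_one_mem_lpSimplex i) v hvm
    ⟨x i, 1 - x i, hpos, hlt', by ring, by
      rw [hv, smul_inv_smul₀ hlt'.ne']
      abel⟩
  apply hlt.ne
  rw [← h, he, lp.single_apply_self]

variable [Fact (1 ≤ p)]

theorem eq_zero_or_one_of_mem_closure_extremePoints_lpSimplex {x : lp (fun _ : ℕ => ℝ) p}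
    (hx : x ∈ closure (extremePoints ℝ (lpSimplex p))) (i : ℕ) : x i = 0 ∨ x i = 1 := by
  have hcl : IsClosed {x : lp (fun _ : ℕ => ℝ) p | x i = 0 ∨ x i = 1} := by
    have hc : Continuous fun x : lp (fun _ : ℕ => ℝ) p => x i :=
      (lp.evalCLM ℝ (fun _ : ℕ => ℝ) p i).continuous
    exact (isClosed_eq hc continuous_const).union (isClosed_eq hc continuous_const)
  exact closure_minimal
    (fun y hy => eq_zero_or_one_of_mem_extremePoints_lpSimplex hy i) hcl hx

/-- Points of the simplex with small coordinates are small in `ℓ_p` if `1 < p`. -/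
theorem norm_le_rpow_of_mem_lpSimplex (hp : p ≠ ∞) {x : lp (fun _ : ℕ => ℝ) p}
    (hx : x ∈ lpSimplex p) {c : ℝ} (hc : 0 < c) (hxc : ∀ i, x i ≤ c) :
    ‖x‖ ≤ c ^ ((p.toReal - 1) / p.toReal) := by
  have hp1 : 1 ≤ p.toReal := by simpa using ENNReal.toReal_mono hp (Fact.out : 1 ≤ p)
  have hp0 : 0 < p.toReal := zero_lt_one.trans_le hp1
  obtain ⟨hx0, hx1⟩ := mem_lpSimplex_iff.1 hx
  refine lp.norm_le_of_forall_sum_le hp0 (Real.rpow_nonneg hc.le _) fun s => ?_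
  -- It remains to use `t ^ p ≤ c ^ (p - 1) * t` for `0 ≤ t ≤ c` and the bound on the mass.
  rw [← Real.rpow_mul hc.le, div_mul_cancel₀ _ hp0.ne']
  calc ∑ i ∈ s, ‖x i‖ ^ p.toReal ≤ ∑ i ∈ s, c ^ (p.toReal - 1) * x i := by
        refine Finset.sum_le_sum fun i _ => ?_
        rw [Real.norm_of_nonneg (hx0 i)]
        rcases (hx0 i).eq_or_lt with h | h
        · rw [← h, Real.zero_rpow hp0.ne', mul_zero]
        · calc x i ^ p.toReal = x i ^ (p.toReal - 1) * x i := by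
                rw [Real.rpow_sub_one h.ne', div_mul_cancel₀ _ h.ne']
            _ ≤ c ^ (p.toReal - 1) * x i := mul_le_mul_of_nonneg_right
                (Real.rpow_le_rpow h.le (hxc i) (by linarith)) h.le
    _ = c ^ (p.toReal - 1) * ∑ i ∈ s, x i := by rw [Finset.mul_sum]
    _ ≤ c ^ (p.toReal - 1) := mul_le_of_le_one_right (Real.rpow_nonneg hc.le _) (hx1 s)

/-- The average of the first `n + 1` unit vectors. -/
noncomputable def uniformAverage (p : ℝ≥0∞) [Fact (1 ≤ p)] (n : ℕ) : lp (fun _ : ℕ => ℝ) p :=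
  ∑ i ∈ Finset.range (n + 1), (1 / ((n : ℝ) + 1)) • lp.single (E := fun _ : ℕ => ℝ) p i (1 : ℝ)

theorem sum_range_one_div (n : ℕ) : ∑ _i ∈ Finset.range (n + 1), 1 / ((n : ℝ) + 1) = 1 := by
  rw [Finset.sum_const, Finset.card_range, nsmul_eq_mul, Nat.cast_add_one,
    mul_one_div_cancel (Nat.cast_add_one_ne_zero n)]

theorem uniformAverage_mem_lpSimplex (n : ℕ) : uniformAverage p n ∈ lpSimplex p :=
  (convex_lpSimplex p).sum_mem (fun _ _ => Nat.one_div_pos_of_nat.le) (sum_range_one_div n)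
    fun i _ => single_one_mem_lpSimplex i

theorem uniformAverage_apply (n i : ℕ) :
    uniformAverage p n i = if i ∈ Finset.range (n + 1) then 1 / ((n : ℝ) + 1) else 0 := by
  rw [uniformAverage, coeFn_finset_sum_smul]
  simp only [lp.coeFn_single, Pi.single_apply, mul_ite, mul_one, mul_zero]
  rw [Finset.sum_ite_eq]

theorem tendsto_uniformAverage (hp1 : 1 < p) (hp : p ≠ ∞) :
    Filter.Tendsto (uniformAverage p) Filter.atTop (nhds 0) := by
  have hp1' : 1 < p.toReal := by
    simpa using (ENNReal.toReal_lt_toReal ENNReal.one_ne_top hp).2 hp1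
  -- The condition `1 < p` is essential here: for `p = 1` the exponent vanishes and the averages
  -- keep norm one.
  have hq : 0 < (p.toReal - 1) / p.toReal := div_pos (by linarith) (by linarith)
  have hlim := (tendsto_one_div_add_atTop_nhds_zero_nat (𝕜 := ℝ)).rpow_const (Or.inr hq.le)
  rw [Real.zero_rpow hq.ne'] at hlim
  refine squeeze_zero_norm (fun n => ?_) hlim
  refine norm_le_rpow_of_mem_lpSimplex hp (uniformAverage_mem_lpSimplex n)
    Nat.one_div_pos_of_nat fun i => ?_
  rw [uniformAverage_apply]
  split_ifs
  exacts [le_rfl, Nat.one_div_pos_of_nat.le]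

end Vertices

/-! ### Failure of openness on the closed extreme boundary. -/

section NotOpen

variable {p : ℝ≥0∞} [Fact (1 ≤ p)]
  [MeasurableSpace (lp (fun _ : ℕ => ℝ) p)] [BorelSpace (lp (fun _ : ℕ => ℝ) p)]

theorem not_isOpenMap_barycenterMap_closure_extremePoints (hp1 : 1 < p) (hp : p ≠ ∞) :
    ¬ IsOpenMap (barycenterMap (closure (extremePoints ℝ (lpSimplex p))) (lpSimplex p)
      (exists_isBarycenter_closure_extremePoints p hp)) := by
  intro hopen
  set B := closure (extremePoints ℝ (lpSimplex p)) with hB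
  set b := barycenterMap B (lpSimplex p) (exists_isBarycenter_closure_extremePoints p hp)
  have hBΔ : B ⊆ lpSimplex p := closure_minimal extremePoints_subset (isClosed_lpSimplex p)
  set g : BoundedContinuousFunction B ℝ := BoundedContinuousFunction.ofNormedAddCommGroup
    (fun y : B => min 1 ‖(y : lp (fun _ : ℕ => ℝ) p)‖) (by fun_prop) 1 (fun y => by
      rw [Real.norm_of_nonneg (le_min zero_le_one (norm_nonneg _))]
      exact min_le_left _ _) with hg
  have hgy : ∀ y : B, g y = min 1 ‖(y : lp (fun _ : ℕ => ℝ) p)‖ := fun _ => rfl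
  -- A weak neighborhood of the Dirac measure at `0`. Openness would give a measure in `U` whose
  -- barycenter is one of the uniform averages.
  set U : Set (ProbabilityMeasure B) := {μ | ∫ y, g y ∂(μ : Measure B) < 1 / 2} with hU
  have hUo : IsOpen U := isOpen_lt
    (ProbabilityMeasure.continuous_integral_boundedContinuousFunction g) continuous_const
  set o : B := ⟨0, subset_closure zero_mem_extremePoints_lpSimplex⟩
  set δ : ProbabilityMeasure B := ⟨Measure.dirac o, inferInstance⟩
  have hδ : δ ∈ U := by
    have : ∫ y, g y ∂(Measure.dirac o) = 0 := by
      rw [integral_dirac, hgy, norm_zero, min_eq_right zero_le_one]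
    change ∫ y, g y ∂(Measure.dirac o) < 1 / 2
    rw [this]
    norm_num
  have hbδ : b δ = ⟨0, zero_mem_lpSimplex⟩ := by
    refine barycenterMap_eq_of_isBarycenter _ fun φ => ⟨?_, ?_⟩
    · exact integrable_dirac (by simp)
    · change ∫ y : B, φ y ∂(Measure.dirac o) = φ 0
      rw [integral_dirac]
  have hlim : Filter.Tendsto
      (fun n => (⟨uniformAverage p n, uniformAverage_mem_lpSimplex n⟩ : lpSimplex p))
      Filter.atTop (nhds ⟨0, zero_mem_lpSimplex⟩) :=
    tendsto_subtype_rng.2 (tendsto_uniformAverage hp1 hp)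
  have hmem : b '' U ∈ nhds (⟨0, zero_mem_lpSimplex⟩ : lpSimplex p) :=
    (hopen U hUo).mem_nhds ⟨δ, hδ, hbδ⟩
  obtain ⟨n, μ, hμ, hbμ⟩ := (hlim.eventually hmem).exists
  have hbar : IsBarycenter μ (uniformAverage p n) := by
    have h := isBarycenter_barycenterMap (exists_isBarycenter_closure_extremePoints p hp) μ
    have h' : ((b μ : lpSimplex p) : lp (fun _ : ℕ => ℝ) p) = uniformAverage p n :=
      congrArg Subtype.val hbμ
    rwa [← h']
  set φ : lp (fun _ : ℕ => ℝ) p →L[ℝ] ℝ :=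
    ∑ i ∈ Finset.range (n + 1), lp.evalCLM ℝ (fun _ : ℕ => ℝ) p i with hφ
  have hφy : ∀ y, φ y = ∑ i ∈ Finset.range (n + 1), y i := fun y => by
    rw [hφ, sum_apply]
    rfl
  -- A nonzero point of `B` has a coordinate equal to one, hence norm at least one, so `g` dominates
  -- the partial mass `φ`. But `φ` integrates to its value at the uniform average, which is one.
  have hle : ∀ y : B, φ y ≤ g y := by
    intro y
    rw [hgy, hφy]
    refine le_min ((mem_lpSimplex_iff.1 (hBΔ y.2)).2 _) ?_
    by_cases h : ∀ i, (y : lp (fun _ : ℕ => ℝ) p) i = 0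
    · rw [Finset.sum_eq_zero fun i _ => h i]
      exact norm_nonneg _
    · push Not at h
      obtain ⟨i, hi⟩ := h
      have hi1 := (eq_zero_or_one_of_mem_closure_extremePoints_lpSimplex y.2 i).resolve_left hi
      refine ((mem_lpSimplex_iff.1 (hBΔ y.2)).2 _).trans ?_
      have := lp.norm_apply_le_norm (zero_lt_one.trans hp1).ne' (y : lp (fun _ : ℕ => ℝ) p) i
      rwa [hi1, norm_one] at this
  have hone : ∫ y : B, φ y ∂(μ : Measure B) = 1 := by
    rw [(hbar φ).2, hφy, ← sum_range_one_div n]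
    refine Finset.sum_congr rfl fun i hi => ?_
    rw [uniformAverage_apply, if_pos hi]
  have h := integral_mono (hbar φ).1 (g.integrable (μ : Measure B)) hle
  rw [hone] at h
  have hμ' : ∫ y, g y ∂(μ : Measure B) < 1 / 2 := hμ
  linarith

end NotOpen

/-! ### Discontinuity of convex hulls. -/

section NotContinuous

variable {p : ℝ≥0∞} [Fact (1 ≤ p)]

theorem StrongCEProperty.ceProperty {E : Type*} [NormedAddCommGroup E] [NormedSpace ℝ E]
    {A : Set E} (h : StrongCEProperty A) : CEProperty A := fun f _ hf => h f hf

/-- The total mass is affine on the simplex and dominates the norm. This minorant keeps the convex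
hull of `-‖x‖` nonnegative at the origin. -/
theorem neg_tsum_mem_convexMinorants_neg_norm (hp : p ≠ ∞) :
    (fun x : lp (fun _ : ℕ => ℝ) p => -∑' i, x i) ∈
      convexMinorants (lpSimplex p) fun x => -‖x‖ := by
  refine ⟨⟨convex_lpSimplex p, fun x hx y hy a b _ _ _ => le_of_eq ?_⟩,
    fun x hx => neg_le_neg (norm_le_tsum_of_mem_lpSimplex hp hx)⟩
  have h : HasSum (fun i => (a • x + b • y : lp (fun _ : ℕ => ℝ) p) i)
      (a * ∑' i, x i + b * ∑' i, y i) :=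
    (hx.2.1.hasSum.mul_left a).add (hy.2.1.hasSum.mul_left b)
  simp only [h.tsum_eq, smul_eq_mul]
  ring

/-- The convex hull of the concave function `x ↦ -‖x‖` is not continuous at the origin. -/
theorem not_ceProperty_lpSimplex (hp1 : 1 < p) (hp : p ≠ ∞) : ¬ CEProperty (lpSimplex p) := by
  intro hCE
  have hconv := convex_lpSimplex p
  set f : lp (fun _ : ℕ => ℝ) p → ℝ := fun x => -‖x‖ with hf
  obtain ⟨C, hC⟩ := (isBounded_lpSimplex p hp).exists_norm_le
  have hcont := hCE f (convexOn_norm hconv).neg ⟨continuous_norm.neg.continuousOn, C, fun x hx => by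
    rw [hf, abs_neg, abs_norm]
    exact hC x hx⟩
  obtain ⟨hcoc, hcof⟩ := convexHullFun_mem (f := f) hconv (C := -C)
    fun x hx => neg_le_neg (hC x hx)
  have h0 : 0 ≤ convexHullFun (lpSimplex p) f 0 := by
    refine le_of_eq_of_le ?_ (le_convexHullFun (neg_tsum_mem_convexMinorants_neg_norm hp)
      zero_mem_lpSimplex)
    simp
  -- Jensen's inequality over the unit vectors, at each of which the hull is at most `-1`.
  have hn : ∀ n, convexHullFun (lpSimplex p) f (uniformAverage p n) ≤ -1 := by
    intro n
    refine (hcoc.map_sum_le (fun _ _ => Nat.one_div_pos_of_nat.le) (sum_range_one_div n)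
      fun i _ => single_one_mem_lpSimplex i).trans ?_
    calc _ ≤ ∑ _i ∈ Finset.range (n + 1), 1 / ((n : ℝ) + 1) * (-1) := by
          refine Finset.sum_le_sum fun i _ => mul_le_mul_of_nonneg_left ?_
            Nat.one_div_pos_of_nat.le
          refine (hcof _ (single_one_mem_lpSimplex i)).trans_eq ?_
          rw [hf]
          simp only
          rw [lp.norm_single (zero_lt_one.trans hp1), norm_one]
      _ = -1 := by rw [← Finset.sum_mul, sum_range_one_div, one_mul]
  have hlim : Filter.Tendsto (uniformAverage p) Filter.atTop
      (nhdsWithin 0 (lpSimplex p)) :=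
    tendsto_nhdsWithin_of_tendsto_nhds_of_eventually_within _ (tendsto_uniformAverage hp1 hp)
      (Filter.Eventually.of_forall uniformAverage_mem_lpSimplex)
  have h := le_of_tendsto ((hcont 0 zero_mem_lpSimplex).tendsto.comp hlim)
    (Filter.Eventually.of_forall hn)
  linarith

end NotContinuous

theorem mainTheorem9 (p : ℝ≥0∞) [Fact (1 ≤ p)] (hp1 : 1 < p) (hp : p ≠ ∞)
    [MeasurableSpace (lp (fun _ : ℕ => ℝ) p)] [BorelSpace (lp (fun _ : ℕ => ℝ) p)] :
    PointwiseMuCompact (lpSimplex p) ∧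
    IsOpenMap (midpointMap (convex_lpSimplex p)) ∧
    IsOpenMap (barycenterMap (lpSimplex p) (lpSimplex p)
      (exists_isBarycenter_lpSimplex p hp)) ∧
    ¬ IsOpenMap (barycenterMap (closure (extremePoints ℝ (lpSimplex p))) (lpSimplex p)
      (exists_isBarycenter_closure_extremePoints p hp)) ∧
    ¬ StrongCEProperty (lpSimplex p) ∧
    ¬ CEProperty (lpSimplex p) :=
  ⟨pointwiseMuCompact_lpSimplex hp, isOpenMap_midpointMap_lpSimplex,
    isOpenMap_barycenterMap_lpSimplex hp,
    not_isOpenMap_barycenterMap_closure_extremePoints hp1 hp,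
    fun h => not_ceProperty_lpSimplex hp1 hp h.ceProperty, not_ceProperty_lpSimplex hp1 hp⟩
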